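/- Let $A$ be a finitely generated abelian group of positive rank whose torsion subgroup is cyclic. A left-invariant circular order on $A$ is a map $\phi: A^3 \to \{-1,0,1\}$ such that $\phi(x,y,z)=0$ if and only if at least two of $x,y,z$ are equal, such that $$\phi(g_1,g_2,g_3)-\phi(g_0,g_2,g_3)+\phi(g_0,g_1,g_3)-\phi(g_0,g_1,g_2)=0$$ for all $g_0,g_1,g_2,g_3\in A$, and such that $\phi(g+g_0,g+g_1,g+g_2)=\phi(g_0,g_1,g_2)$ for all $g,g_0,g_1,g_2\in A$. Let $\mathrm{CO}(A)$ be the set of all left-invariant circular orders on $A$, with the subspace topology from $\{-1,0,1\}^{A^3}$, where $\{-1,0,1\}$ is discrete and $\{-1,0,1\}^{A^3}$ has the product topology. Then $\mathrm{CO}(A)$ is homeomorphic to the Cantor set. -/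

import Mathlib

/-- The degenerate set `Δ₃(G)` of all triples with a repeated entry. -/
def degenerateTriples (G : Type*) : Set (G × G × G) :=
  {t | t.1 = t.2.1 ∨ t.2.1 = t.2.2 ∨ t.1 = t.2.2}

/-- A circular order on a set `G`: a map `φ : G³ → {-1, 0, 1}` (`SignType` is the three-element
type `{-1, 0, 1}`) which vanishes exactly on the degenerate triples and is a 2-cocycle. -/
structure IsCircularOrder {G : Type*} (φ : G × G × G → SignType) : Prop where
  preimage_zero : φ ⁻¹' {0} = degenerateTriples G
  cocycle : ∀ g₀ g₁ g₂ g₃ : G,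
    (φ (g₁, g₂, g₃) : ℤ) - (φ (g₀, g₂, g₃) : ℤ) + (φ (g₀, g₁, g₃) : ℤ)
      - (φ (g₀, g₁, g₂) : ℤ) = 0

/-- A left-invariant (homogeneous) circular order on a group `G`, written additively. -/
structure IsLeftInvariantCircularOrder {G : Type*} [AddGroup G]
    (φ : G × G × G → SignType) : Prop extends IsCircularOrder φ where
  homogeneous : ∀ g g₀ g₁ g₂ : G, φ (g + g₀, g + g₁, g + g₂) = φ (g₀, g₁, g₂)

/-- The space `CO(G)` of left-invariant circular orders on `G`. As a type it carries the subspace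
topology of `{-1, 0, 1}^(G³)`, which has the product topology of the discrete topology
on `{-1, 0, 1}`. -/
def CO (G : Type*) [AddGroup G] : Set (G × G × G → SignType) :=
  {φ | IsLeftInvariantCircularOrder φ}

/-! By Brouwer's characterization it suffices that the space is nonempty, compact, has a countable
separating family of clopen sets, and has no isolated points. Compactness holds because the axioms
are closed conditions in a compact product; separation uses the conditions `φ t = s`, countable in
number since `A` is countable. An element exists because `A` splits as cyclic torsion plus a free,
hence orderable, group: compare torsion parts cyclically, then free parts linearly.

The absence of isolated points (`exists_ne_circularOrder_of_finset`) is the core. Cutting `φ` open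
at `0` gives a linear order whose carry is a 2-cocycle, so `A` is the quotient by `ℤ` of an ordered
abelian group. That group is finitely generated and torsion-free, so by Gordan's theorem finitely
many of its positive elements are positive under one integral functional. If `m` is the functional's
value at the generator of `ℤ`, it descends to `ψ : A →+ ZMod m`, which already determines `φ` on a
prescribed finite set. As `A` is infinite, `ψ` has a nontrivial kernel; ordering it in two opposite
ways yields two distinct circular orders that agree with `φ` on the finite set, and one of them is
not `φ`. -/

/-! ### Brouwer's theorem through a binary tree of clopen pieces. -/

/-- The least `k` such that `C k` properly splits `U`. -/
noncomputable def splitIndex {X : Type*} (C : ℕ → Set X) (U : Set X) : ℕ :=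
  sInf {k | (U ∩ C k).Nonempty ∧ (U \ C k).Nonempty}

/-- The half of `U` selected by `b` when `U` is cut along the first `C k` that splits it. -/
noncomputable def splitHalf {X : Type*} (C : ℕ → Set X) (U : Set X) (b : Bool) : Set X :=
  if b then U ∩ C (splitIndex C U) else U \ C (splitIndex C U)

/-- The piece of `X` reached after following the first `n` entries of `y`. -/
noncomputable def splitPiece {X : Type*} (C : ℕ → Set X) (y : ℕ → Bool) : ℕ → Set X
  | 0 => Set.univ
  | n + 1 => splitHalf C (splitPiece C y n) (y n)

open Classical in
/-- The piece of the `n`-th splitting stage which contains `x`. -/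
noncomputable def pieceAt {X : Type*} (C : ℕ → Set X) (x : X) : ℕ → Set X
  | 0 => Set.univ
  | n + 1 => splitHalf C (pieceAt C x n) (decide (x ∈ C (splitIndex C (pieceAt C x n))))

open Classical in
/-- The sequence of answers describing the position of `x` in the splitting tree. -/
noncomputable def splitCode {X : Type*} (C : ℕ → Set X) (x : X) (n : ℕ) : Bool :=
  decide (x ∈ C (splitIndex C (pieceAt C x n)))

section Splitting

variable {X : Type*} {C : ℕ → Set X}

theorem splitHalf_subset (U : Set X) (b : Bool) : splitHalf C U b ⊆ U := by
  unfold splitHalf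
  split_ifs
  · exact Set.inter_subset_left
  · exact Set.sdiff_subset

theorem mem_pieceAt (x : X) (n : ℕ) : x ∈ pieceAt C x n := by
  induction n with
  | zero => trivial
  | succ n ih =>
    by_cases h : x ∈ C (splitIndex C (pieceAt C x n)) <;> simp [pieceAt, splitHalf, h, ih]

theorem pieceAt_subset (x : X) (n : ℕ) : pieceAt C x (n + 1) ⊆ pieceAt C x n :=
  splitHalf_subset _ _

theorem splitPiece_subset (y : ℕ → Bool) (n : ℕ) : splitPiece C y (n + 1) ⊆ splitPiece C y n :=
  splitHalf_subset _ _

theorem mem_iff_of_mem_pieceAt_succ {x x' : X} {n : ℕ} (h : x' ∈ pieceAt C x (n + 1)) :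
    x' ∈ C (splitIndex C (pieceAt C x n)) ↔ x ∈ C (splitIndex C (pieceAt C x n)) := by
  by_cases hx : x ∈ C (splitIndex C (pieceAt C x n)) <;>
    simp_all [pieceAt, splitHalf]

theorem pieceAt_eq_of_mem {x x' : X} {n : ℕ} (h : x' ∈ pieceAt C x n) :
    pieceAt C x' n = pieceAt C x n := by
  induction n with
  | zero => rfl
  | succ n ih =>
    have e := ih (pieceAt_subset x n h)
    have := mem_iff_of_mem_pieceAt_succ h
    rw [pieceAt, pieceAt, e, decide_eq_decide.2 this]

theorem pieceAt_eq_of_splitCode_eq {x x' : X} (h : splitCode C x = splitCode C x') (n : ℕ) :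
    pieceAt C x n = pieceAt C x' n := by
  induction n with
  | zero => rfl
  | succ n ih =>
    have e := congrFun h n
    simp only [splitCode] at e
    simp only [pieceAt, e, ih]

/-- After `n` cuts, the sets `C k` with `k < n` do not split the piece any more. -/
theorem not_split_pieceAt (hC : ∀ n x, ∃ k, (pieceAt C x n ∩ C k).Nonempty ∧
    (pieceAt C x n \ C k).Nonempty) (x : X) (n k : ℕ) (hk : k < n) :
    ¬ ((pieceAt C x n ∩ C k).Nonempty ∧ (pieceAt C x n \ C k).Nonempty) := by
  induction n generalizing k with
  | zero => omega
  | succ n ih =>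
    rintro ⟨⟨a, ha, hak⟩, ⟨b, hb, hbk⟩⟩
    have hs : ((pieceAt C x n ∩ C k).Nonempty ∧ (pieceAt C x n \ C k).Nonempty) :=
      ⟨⟨a, pieceAt_subset x n ha, hak⟩, ⟨b, pieceAt_subset x n hb, hbk⟩⟩
    obtain rfl : k = n := by
      by_contra hne
      exact ih k (by omega) hs
    -- No earlier set splits the stage-`k` piece, so if `C k` splits it, the cut made there is along
    -- `C k` itself.
    have h2 : ¬ splitIndex C (pieceAt C x k) < k := fun hlt =>
      ih _ hlt (Nat.sInf_mem (hC k x))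
    have e : splitIndex C (pieceAt C x k) = k := le_antisymm (Nat.sInf_le hs) (not_lt.1 h2)
    have ea := mem_iff_of_mem_pieceAt_succ ha
    have eb := mem_iff_of_mem_pieceAt_succ hb
    rw [e] at ea eb
    exact hbk (eb.2 (ea.1 hak))

theorem pieceAt_eq_splitPiece {x : X} {y : ℕ → Bool} (h : ∀ n, x ∈ splitPiece C y n) (n : ℕ) :
    pieceAt C x n = splitPiece C y n := by
  induction n with
  | zero => rfl
  | succ n ih =>
    have := h (n + 1)
    cases hy : y n <;> simp_all [splitPiece, splitHalf, pieceAt]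

theorem splitCode_eq {x : X} {y : ℕ → Bool} (h : ∀ n, x ∈ splitPiece C y n) :
    splitCode C x = y := by
  funext n
  have := h (n + 1)
  have e := pieceAt_eq_splitPiece h n
  cases hy : y n <;> simp_all [splitPiece, splitHalf, splitCode]

variable [TopologicalSpace X]

theorem isClopen_splitHalf (hC : ∀ k, IsClopen (C k)) {U : Set X} (hU : IsClopen U) (b : Bool) :
    IsClopen (splitHalf C U b) := by
  unfold splitHalf
  split_ifs
  · exact hU.inter (hC _)
  · exact hU.diff (hC _)

theorem isClopen_pieceAt (hC : ∀ k, IsClopen (C k)) (x : X) (n : ℕ) :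
    IsClopen (pieceAt C x n) := by
  induction n with
  | zero => exact isClopen_univ
  | succ n ih => exact isClopen_splitHalf hC ih _

theorem isClopen_splitPiece (hC : ∀ k, IsClopen (C k)) (y : ℕ → Bool) (n : ℕ) :
    IsClopen (splitPiece C y n) := by
  induction n with
  | zero => exact isClopen_univ
  | succ n ih => exact isClopen_splitHalf hC ih _

theorem continuous_splitCode (hC : ∀ k, IsClopen (C k)) : Continuous (splitCode C) := by
  refine continuous_pi fun n => IsLocallyConstant.continuous ?_
  rw [IsLocallyConstant.iff_exists_open]
  refine fun x => ⟨pieceAt C x (n + 1), (isClopen_pieceAt hC x _).isOpen, mem_pieceAt x _, ?_⟩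
  intro x' hx'
  rw [splitCode, splitCode, decide_eq_decide, pieceAt_eq_of_mem (pieceAt_subset x n hx')]
  exact mem_iff_of_mem_pieceAt_succ hx'

/-- **Brouwer's characterization of the Cantor space**, for a compact space without isolated points
whose points are separated by a given sequence of clopen sets. -/
theorem nonempty_homeomorph_cantorSpace [CompactSpace X] [Nonempty X]
    (hC : ∀ k, IsClopen (C k))
    (hsep : ∀ x x' : X, x ≠ x' → ∃ k, ¬ (x ∈ C k ↔ x' ∈ C k))
    (hperf : ∀ (U : Set X), IsOpen U → ∀ x ∈ U, ∃ x' ∈ U, x' ≠ x) :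
    Nonempty (X ≃ₜ (ℕ → Bool)) := by
  have hsplit : ∀ U : Set X, IsOpen U → U.Nonempty →
      ∃ k, (U ∩ C k).Nonempty ∧ (U \ C k).Nonempty := by
    rintro U hU ⟨x, hx⟩
    obtain ⟨x', hx', hne⟩ := hperf U hU x hx
    obtain ⟨k, hk⟩ := hsep x' x hne
    by_cases h : x ∈ C k
    · exact ⟨k, ⟨x, hx, h⟩, ⟨x', hx', fun h' => hk (iff_of_true h' h)⟩⟩
    · refine ⟨k, ⟨x', hx', ?_⟩, ⟨x, hx, h⟩⟩
      by_contra h'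
      exact hk (iff_of_false h' h)
  have hinj : Function.Injective (splitCode C) := by
    intro x x' h
    by_contra hne
    obtain ⟨k, hk⟩ := hsep x x' hne
    have hns := not_split_pieceAt (fun n x => hsplit _ (isClopen_pieceAt hC x n).isOpen
      ⟨x, mem_pieceAt x n⟩) x (k + 1) k (Nat.lt_succ_self k)
    have hx := mem_pieceAt (C := C) x (k + 1)
    have hx' := mem_pieceAt (C := C) x' (k + 1)
    rw [← pieceAt_eq_of_splitCode_eq h] at hx'
    by_cases hxk : x ∈ C k <;> by_cases hxk' : x' ∈ C k
    · exact hk (iff_of_true hxk hxk')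
    · exact hns ⟨⟨x, hx, hxk⟩, ⟨x', hx', hxk'⟩⟩
    · exact hns ⟨⟨x', hx', hxk'⟩, ⟨x, hx, hxk⟩⟩
    · exact hk (iff_of_false hxk hxk')
  have hsurj : Function.Surjective (splitCode C) := by
    intro y
    have hne : ∀ n, (splitPiece C y n).Nonempty := by
      intro n
      induction n with
      | zero => exact Set.univ_nonempty
      | succ n ih =>
        have := Nat.sInf_mem (hsplit _ (isClopen_splitPiece hC y n).isOpen ih)
        simp only [splitPiece, splitHalf]
        split_ifs
        exacts [this.1, this.2]
    -- Compactness gives a point on every infinite branch of the tree.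
    obtain ⟨x, hx⟩ := IsCompact.nonempty_iInter_of_sequence_nonempty_isCompact_isClosed
      (splitPiece C y) (splitPiece_subset y) hne (isClopen_splitPiece hC y 0).isClosed.isCompact
      (fun n => (isClopen_splitPiece hC y n).isClosed)
    exact ⟨x, splitCode_eq (Set.mem_iInter.1 hx)⟩
  exact ⟨(continuous_splitCode hC).homeoOfEquivCompactToT2
    (f := Equiv.ofBijective (splitCode C) ⟨hinj, hsurj⟩)⟩

end Splitting

/-! ### Circular orders from linear orders. -/

/-- The order comparison of `x` and `y` with respect to a relation `L`, as an integer: `1` if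
`L x y`, `-1` if `L y x`, and `0` otherwise. -/
noncomputable def compareSign {A : Type*} (L : A → A → Prop) (x y : A) : ℤ :=
  open Classical in if L x y then 1 else if L y x then -1 else 0

/-- The circular order obtained by closing up a linear order. -/
noncomputable def circularClosure {A : Type*} (L : A → A → Prop) (t : A × A × A) : SignType :=
  SignType.sign (compareSign L t.1 t.2.1 + compareSign L t.2.1 t.2.2 + compareSign L t.2.2 t.1)

section CompareSign

variable {A : Type*} {L : A → A → Prop}

theorem compareSign_of_lt {x y : A} (h : L x y) : compareSign L x y = 1 := by
  simp [compareSign, h]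

theorem compareSign_self [Std.Irrefl L] (x : A) : compareSign L x x = 0 := by
  simp [compareSign, irrefl_of L]

theorem compareSign_swap [IsStrictTotalOrder A L] (x y : A) :
    compareSign L y x = - compareSign L x y := by
  rcases trichotomous_of L x y with h | rfl | h
  · simp [compareSign, h, asymm_of L h]
  · simp [compareSign, irrefl_of L]
  · simp [compareSign, h, asymm_of L h]

theorem compareSign_of_gt [IsStrictTotalOrder A L] {x y : A} (h : L y x) :
    compareSign L x y = -1 := by
  rw [compareSign_swap y x, compareSign_of_lt h]

theorem compareSign_of_ne [IsStrictTotalOrder A L] {x y : A} (h : x ≠ y) :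
    compareSign L x y = 1 ∨ compareSign L x y = -1 := by
  rcases trichotomous_of L x y with h' | h' | h'
  · exact .inl (compareSign_of_lt h')
  · exact absurd h' h
  · exact .inr (compareSign_of_gt h')

/-- Transitivity excludes the sums `3` and `-3`, so taking the sign loses nothing and identities can
be checked linearly in ℤ. -/
theorem coe_circularClosure [IsStrictTotalOrder A L] (x y z : A) :
    (circularClosure L (x, y, z) : ℤ) =
      compareSign L x y + compareSign L y z + compareSign L z x := by
  simp only [circularClosure]
  rcases trichotomous_of L x y with h1 | rfl | h1
  · rcases trichotomous_of L y z with h2 | rfl | h2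
    · have h3 := trans_of L h1 h2
      simp [compareSign_of_lt, compareSign_of_gt, *]
    · simp [compareSign_self, compareSign_swap x y]
    · rcases trichotomous_of L x z with h3 | rfl | h3 <;>
        simp [compareSign_of_lt, compareSign_of_gt, compareSign_self, *]
  · simp [compareSign_self, compareSign_swap x z]
  · rcases trichotomous_of L y z with h2 | rfl | h2
    · rcases trichotomous_of L x z with h3 | rfl | h3 <;>
        simp [compareSign_of_lt, compareSign_of_gt, compareSign_self, *]
    · simp [compareSign_self, compareSign_swap x y]
    · have h3 := trans_of L h2 h1
      simp [compareSign_of_lt, compareSign_of_gt, *]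

theorem isCircularOrder_circularClosure [IsStrictTotalOrder A L] :
    IsCircularOrder (circularClosure L) where
  preimage_zero := by
    ext ⟨x, y, z⟩
    have key : circularClosure L (x, y, z) = 0 ↔ (circularClosure L (x, y, z) : ℤ) = 0 := by
      cases circularClosure L (x, y, z) <;> simp
    simp only [Set.mem_preimage, Set.mem_singleton_iff, degenerateTriples, Set.mem_ofPred_eq]
    rw [key, coe_circularClosure]
    constructor
    · intro h
      by_contra hne
      push Not at hne
      have h1 := compareSign_of_ne (L := L) hne.1
      have h2 := compareSign_of_ne (L := L) hne.2.1
      have h3 := compareSign_of_ne (L := L) hne.2.2.symm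
      omega
    · rintro (rfl | rfl | rfl)
      · simp [compareSign_self, compareSign_swap x z]
      · simp [compareSign_self, compareSign_swap x y]
      · simp [compareSign_self, compareSign_swap x y]
  cocycle a b c d := by
    simp only [coe_circularClosure]
    linarith [compareSign_swap (L := L) a c, compareSign_swap (L := L) b d,
      compareSign_swap (L := L) a d, compareSign_swap (L := L) b c,
      compareSign_swap (L := L) a b, compareSign_swap (L := L) c d]

/-- If translations change the comparison of two elements by a coboundary, the circular closure
is left-invariant. -/
theorem circularClosure_mem_CO [AddGroup A] [IsStrictTotalOrder A L] (ε : A → A → ℤ)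
    (h : ∀ g x y, compareSign L (g + x) (g + y) = compareSign L x y + (ε g x - ε g y)) :
    circularClosure L ∈ CO A where
  toIsCircularOrder := isCircularOrder_circularClosure
  homogeneous g x y z := by
    simp only [circularClosure, h]
    congr 1
    ring

end CompareSign

/-! ### Cutting a circular order open at zero. -/

section CircularOrder

variable {A : Type*} {φ : A × A × A → SignType}

theorem IsCircularOrder.eq_zero_iff (hφ : IsCircularOrder φ) (x y z : A) :
    (φ (x, y, z) : ℤ) = 0 ↔ x = y ∨ y = z ∨ x = z := by
  have h : φ (x, y, z) = 0 ↔ (x, y, z) ∈ degenerateTriples A := by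
    rw [← hφ.preimage_zero]
    rfl
  have key : φ (x, y, z) = 0 ↔ (φ (x, y, z) : ℤ) = 0 := by
    cases φ (x, y, z) <;> simp
  rw [← key, h]
  rfl

theorem IsCircularOrder.self_left (hφ : IsCircularOrder φ) (x y : A) :
    (φ (x, x, y) : ℤ) = 0 := (hφ.eq_zero_iff _ _ _).2 (by simp)

theorem IsCircularOrder.self_right (hφ : IsCircularOrder φ) (x y : A) :
    (φ (x, y, y) : ℤ) = 0 := (hφ.eq_zero_iff _ _ _).2 (by simp)

theorem IsCircularOrder.self_outer (hφ : IsCircularOrder φ) (x y : A) :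
    (φ (x, y, x) : ℤ) = 0 := (hφ.eq_zero_iff _ _ _).2 (by simp)

theorem IsCircularOrder.swap_right (hφ : IsCircularOrder φ) (x y z : A) :
    (φ (x, z, y) : ℤ) = - φ (x, y, z) := by
  have := hφ.cocycle x y z y
  linarith [hφ.self_outer y z, hφ.self_right x y]

theorem coe_eq_one_iff (s : SignType) : (s : ℤ) = 1 ↔ s = 1 := by
  cases s <;> simp

theorem coe_eq_zero_or (s : SignType) : (s : ℤ) = 0 ∨ (s : ℤ) = 1 ∨ (s : ℤ) = -1 := by
  cases s <;> simp

end CircularOrder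

section BasePoint

variable {A : Type*} [Zero A] {φ : A × A × A → SignType}

/-- The linear order with least element `0` obtained by cutting a circular order open at `0`. -/
def cutAtZero (φ : A × A × A → SignType) (x y : A) : Prop :=
  x ≠ y ∧ (x = 0 ∨ y ≠ 0 ∧ φ (0, x, y) = 1)

theorem cutAtZero_iff (φ : A × A × A → SignType) (x y : A) :
    cutAtZero φ x y ↔ x ≠ y ∧ (x = 0 ∨ y ≠ 0 ∧ (φ (0, x, y) : ℤ) = 1) := by
  rw [cutAtZero, coe_eq_one_iff]

theorem isStrictTotalOrder_cutAtZero (hφ : IsCircularOrder φ) :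
    IsStrictTotalOrder A (cutAtZero φ) where
  irrefl x h := h.1 rfl
  trichotomous x y h1 h2 := by
    by_contra hne
    rw [cutAtZero_iff] at h1 h2
    have hx : x ≠ 0 := by rintro rfl; exact h1 ⟨hne, .inl rfl⟩
    have hy : y ≠ 0 := by rintro rfl; exact h2 ⟨Ne.symm hne, .inl rfl⟩
    have h1' : (φ (0, x, y) : ℤ) ≠ 1 := fun h => h1 ⟨hne, .inr ⟨hy, h⟩⟩
    have h2' : (φ (0, y, x) : ℤ) ≠ 1 := fun h => h2 ⟨Ne.symm hne, .inr ⟨hx, h⟩⟩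
    rw [hφ.swap_right] at h2'
    have h0 : (φ (0, x, y) : ℤ) ≠ 0 := by
      rw [Ne, hφ.eq_zero_iff]
      tauto
    have := coe_eq_zero_or (φ (0, x, y))
    omega
  trans x y z h1 h2 := by
    rw [cutAtZero_iff] at *
    obtain ⟨hxy, h1⟩ := h1
    obtain ⟨hyz, h2⟩ := h2
    rcases h1 with rfl | ⟨hy, h1⟩
    · rcases h2 with rfl | ⟨hz, h2⟩
      · exact absurd rfl hxy
      · exact ⟨hz.symm, .inl rfl⟩
    · rcases h2 with rfl | ⟨hz, h2⟩
      · exact absurd rfl hy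
      · have hc := hφ.cocycle 0 x y z
        have hxz : x ≠ z := by
          rintro rfl
          rw [hφ.swap_right] at h2
          omega
        refine ⟨hxz, .inr ⟨hz, ?_⟩⟩
        have := coe_eq_zero_or (φ (0, x, z))
        have := coe_eq_zero_or (φ (x, y, z))
        have h3 : (φ (0, x, z) : ℤ) ≠ 0 := by
          rw [Ne, hφ.eq_zero_iff]
          rintro (rfl | rfl | rfl)
          · simp [hφ.self_left] at h1
          · exact hxz rfl
          · exact hz rfl
        omega

open Classical in
-- The correction terms form a coboundary, so they cancel around a triangle; this is what makes
-- closing up undo cutting.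
theorem compareSign_cutAtZero (hφ : IsCircularOrder φ) (x y : A) :
    compareSign (cutAtZero φ) x y =
      φ (0, x, y) + ((if x = 0 then 1 else 0) - if y = 0 then 1 else 0) := by
  have := isStrictTotalOrder_cutAtZero hφ
  have aux : ∀ x y, cutAtZero φ x y → (φ (0, x, y) : ℤ) +
      ((if x = 0 then 1 else 0) - if y = 0 then 1 else 0) = 1 := by
    intro x y h
    rw [cutAtZero_iff] at h
    rcases h with ⟨hne, rfl | ⟨hy, h⟩⟩
    · simp [hφ.self_left, hne.symm]
    · have hx : x ≠ 0 := by rintro rfl; simp [hφ.self_left] at h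
      simp [hx, hy, h]
  rcases trichotomous_of (cutAtZero φ) x y with h | rfl | h
  · rw [compareSign_of_lt h, aux x y h]
  · simp [compareSign_self, hφ.self_right]
  · rw [compareSign_of_gt h, hφ.swap_right]
    linarith [aux y x h]

theorem circularClosure_cutAtZero (hφ : IsCircularOrder φ) :
    circularClosure (cutAtZero φ) = φ := by
  have := isStrictTotalOrder_cutAtZero hφ
  have hcoe : ∀ s t : SignType, (s : ℤ) = t → s = t := by
    intro s t
    cases s <;> cases t <;> simp
  funext ⟨x, y, z⟩
  apply hcoe
  rw [coe_circularClosure]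
  simp only [compareSign_cutAtZero hφ]
  linarith [hφ.cocycle 0 x y z, hφ.swap_right 0 x z]

end BasePoint

/-! ### The carry cocycle and the ordered extension by ℤ. -/

/-- The axioms satisfied by the carry `ε a b` of an addition in which the group `A` is the
quotient of an ordered group by a cofinal cyclic subgroup, the elements of `A` being represented
in a fundamental interval. -/
structure IsCarry {A : Type*} [AddCommGroup A] (ε : A → A → ℤ) : Prop where
  assoc : ∀ a b c, ε a b + ε (a + b) c = ε b c + ε a (b + c)
  comm : ∀ a b, ε a b = ε b a
  zero_left : ∀ a, ε 0 a = 0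
  nonneg : ∀ a b, 0 ≤ ε a b
  add_neg : ∀ a, a ≠ 0 → ε a (-a) = 1

section Cut

variable {A : Type*} [AddCommGroup A] {L : A → A → Prop}

/-- The carry of an addition with respect to a linear order. -/
noncomputable def carry (L : A → A → Prop) (g x : A) : ℤ :=
  open Classical in if L (g + x) g then 1 else 0

/-- Writing the carry through comparison signs lets left-invariance, an identity between signs,
yield the cocycle law. -/
theorem two_mul_carry [IsStrictTotalOrder A L] (h0 : ∀ x, x ≠ 0 → L 0 x) (g x : A) :
    2 * carry L g x = compareSign L (g + x) g - compareSign L x 0 := by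
  by_cases hx : x = 0
  · simp [hx, carry, compareSign_self, irrefl_of L]
  · rw [compareSign_of_gt (h0 x hx)]
    by_cases hg : L (g + x) g
    · simp [carry, hg, compareSign_of_lt hg]
    · have : g + x ≠ g := by simpa using hx
      rcases trichotomous_of L (g + x) g with h | h | h
      · exact absurd h hg
      · exact absurd h this
      · simp [carry, hg, compareSign_of_gt h]

theorem compareSign_add_left [IsStrictTotalOrder A L] (h0 : ∀ x, x ≠ 0 → L 0 x)
    (hL : circularClosure L ∈ CO A) (g x y : A) :
    compareSign L (g + x) (g + y) = compareSign L x y + (2 * carry L g x - 2 * carry L g y) := by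
  have h := congrArg (fun s : SignType => (s : ℤ)) (hL.homogeneous g x y 0)
  simp only [coe_circularClosure, add_zero] at h
  rw [two_mul_carry h0, two_mul_carry h0]
  linarith [compareSign_swap (L := L) g (g + x), compareSign_swap (L := L) 0 x]

theorem carry_assoc [IsStrictTotalOrder A L] (h0 : ∀ x, x ≠ 0 → L 0 x)
    (hL : circularClosure L ∈ CO A) (a b c : A) :
    carry L a b + carry L (a + b) c = carry L b c + carry L a (b + c) := by
  have h1 := compareSign_add_left h0 hL a (b + c) b
  have h2 := two_mul_carry h0 (a + b) c
  have h3 := two_mul_carry h0 b c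
  rw [add_assoc] at h2
  linarith

/-- The failure of commutativity of a carry is additive in each variable, and it is bounded,
so it vanishes. -/
theorem carry_comm [IsStrictTotalOrder A L] (h0 : ∀ x, x ≠ 0 → L 0 x)
    (hL : circularClosure L ∈ CO A) (a b : A) : carry L a b = carry L b a := by
  have hadd : ∀ g h k : A, carry L (g + h) k - carry L k (g + h) =
      (carry L g k - carry L k g) + (carry L h k - carry L k h) := by
    intro g h k
    have h1 := carry_assoc h0 hL g h k
    have h2 := carry_assoc h0 hL k g h
    have h3 := carry_assoc h0 hL g k h
    rw [add_comm k h, add_comm g k] at h3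
    linarith
  have hb : ∀ x y : A, 0 ≤ carry L x y ∧ carry L x y ≤ 1 := by
    intro x y
    unfold carry
    split_ifs <;> simp
  have h := hadd a a b
  have := hb (a + a) b
  have := hb b (a + a)
  omega

theorem isCarry_carry [IsStrictTotalOrder A L] (h0 : ∀ x, x ≠ 0 → L 0 x)
    (hL : circularClosure L ∈ CO A) : IsCarry (carry L) where
  assoc := carry_assoc h0 hL
  comm := carry_comm h0 hL
  zero_left a := by
    have : ¬ L a 0 := by
      by_cases ha : a = 0
      · exact ha ▸ irrefl_of L 0
      · exact asymm_of L (h0 a ha)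
    simp [carry, this]
  nonneg a b := by
    unfold carry
    split_ifs <;> simp
  add_neg a ha := by simp [carry, h0 a ha]

end Cut

/-- The extension of `A` by `ℤ` defined by a carry. -/
def CarryExtension {A : Type*} [AddCommGroup A] {ε : A → A → ℤ} (_ : IsCarry ε) : Type _ := ℤ × A

namespace CarryExtension

variable {A : Type*} [AddCommGroup A] {ε : A → A → ℤ} {hε : IsCarry ε}

theorem _root_.IsCarry.zero_right (hε : IsCarry ε) (a : A) : ε a 0 = 0 := by
  rw [hε.comm, hε.zero_left]

instance : Zero (CarryExtension hε) := ⟨((0 : ℤ), (0 : A))⟩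

instance : Add (CarryExtension hε) := ⟨fun x y => (x.1 + y.1 + ε x.2 y.2, x.2 + y.2)⟩

instance : Neg (CarryExtension hε) := ⟨fun x => (-x.1 - ε x.2 (-x.2), -x.2)⟩

instance : AddCommGroup (CarryExtension hε) where
  add_assoc x y z := Prod.ext (by
    change x.1 + y.1 + ε x.2 y.2 + z.1 + ε (x.2 + y.2) z.2 =
      x.1 + (y.1 + z.1 + ε y.2 z.2) + ε x.2 (y.2 + z.2)
    linarith [hε.assoc x.2 y.2 z.2]) (add_assoc _ _ _)
  zero_add x := Prod.ext (by
    change 0 + x.1 + ε 0 x.2 = x.1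
    simp [hε.zero_left]) (zero_add _)
  add_zero x := Prod.ext (by
    change x.1 + 0 + ε x.2 0 = x.1
    simp [hε.zero_right]) (add_zero _)
  add_comm x y := Prod.ext (by
    change x.1 + y.1 + ε x.2 y.2 = y.1 + x.1 + ε y.2 x.2
    rw [hε.comm, add_comm x.1]) (add_comm _ _)
  neg_add_cancel x := Prod.ext (by
    change -x.1 - ε x.2 (-x.2) + x.1 + ε (-x.2) x.2 = 0
    rw [hε.comm (-x.2)]
    ring) (neg_add_cancel _)
  nsmul := nsmulRec
  zsmul := zsmulRec

/-- The element of the extension with given coordinates. -/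
def mk (hε : IsCarry ε) (i : ℤ) (a : A) : CarryExtension hε := (i, a)

theorem mk_add (i j : ℤ) (a b : A) : mk hε i a + mk hε j b = mk hε (i + j + ε a b) (a + b) := rfl

theorem mk_eq_zero {i : ℤ} {a : A} : mk hε i a = 0 ↔ i = 0 ∧ a = 0 := Prod.ext_iff

/-- The projection onto `A`. -/
def proj (hε : IsCarry ε) : CarryExtension hε →+ A where
  toFun x := x.2
  map_zero' := rfl
  map_add' _ _ := rfl

/-- The inclusion of `ℤ`. -/
def incl (hε : IsCarry ε) : ℤ →+ CarryExtension hε where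
  toFun i := mk hε i 0
  map_zero' := rfl
  map_add' i j := by rw [mk_add, hε.zero_left, add_zero, add_zero]

theorem ker_proj (x : CarryExtension hε) : proj hε x = 0 ↔ x ∈ Set.range (incl hε) := by
  constructor
  · intro h
    exact ⟨x.1, Prod.ext rfl h.symm⟩
  · rintro ⟨i, rfl⟩
    rfl

/-- The positive elements of the extension. -/
def Pos (x : CarryExtension hε) : Prop := 0 ≤ x.1 ∧ x ≠ 0

theorem pos_mk {i : ℤ} {a : A} : Pos (mk hε i a) ↔ 0 ≤ i ∧ ¬ (i = 0 ∧ a = 0) := by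
  rw [Pos, Ne, mk_eq_zero]
  rfl

theorem Pos.add {x y : CarryExtension hε} (hx : Pos x) (hy : Pos y) : Pos (x + y) := by
  obtain ⟨i, a⟩ := x
  obtain ⟨j, b⟩ := y
  change Pos (mk hε i a) at hx
  change Pos (mk hε j b) at hy
  change Pos (mk hε i a + mk hε j b)
  rw [mk_add, pos_mk]
  rw [pos_mk] at hx hy
  have h := hε.nonneg a b
  refine ⟨by omega, ?_⟩
  rintro ⟨h1, h2⟩
  obtain rfl : b = -a := by rw [← add_eq_zero_iff_neg_eq.1 h2]
  by_cases ha : a = 0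
  · subst ha
    have h3 := hx.2
    simp at h3
    omega
  · rw [hε.add_neg a ha] at h1
    omega

theorem not_pos_zero : ¬ Pos (0 : CarryExtension hε) := fun h => h.2 rfl

theorem pos_or_pos_neg {x : CarryExtension hε} (hx : x ≠ 0) : Pos x ∨ Pos (-x) := by
  by_cases h : 0 ≤ x.1
  · exact .inl ⟨h, hx⟩
  · refine .inr ⟨?_, neg_ne_zero.2 hx⟩
    change 0 ≤ -x.1 - ε x.2 (-x.2)
    by_cases ha : x.2 = 0
    · simp only [ha, neg_zero, hε.zero_left]
      omega
    · rw [hε.add_neg _ ha]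
      omega

theorem Pos.succ_nsmul {x : CarryExtension hε} (hx : Pos x) (n : ℕ) : Pos ((n + 1) • x) := by
  induction n with
  | zero => simpa using hx
  | succ n ih =>
    rw [_root_.succ_nsmul]
    exact ih.add hx

/-- A nonzero element or its negative is positive, and multiples of positive elements stay positive.
-/
instance : Module.IsTorsionFree ℤ (CarryExtension hε) := by
  rw [Module.isTorsionFree_int_iff_isAddTorsionFree]
  refine ⟨fun n hn x y hxy => ?_⟩
  obtain ⟨n, rfl⟩ := Nat.exists_eq_succ_of_ne_zero hn
  by_contra hne
  have hxy' : (n + 1) • (x - y) = 0 := by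
    rw [nsmul_sub]
    exact sub_eq_zero.2 hxy
  rcases pos_or_pos_neg (sub_ne_zero.2 hne) with h | h
  · exact (h.succ_nsmul n).2 hxy'
  · exact (h.succ_nsmul n).2 (by rw [smul_neg, hxy', neg_zero])

instance [AddGroup.FG A] : Module.Finite ℤ (CarryExtension hε) := by
  have : Module.Finite ℤ A := Module.Finite.iff_addGroup_fg.2 inferInstance
  exact Module.Finite.of_exact (f := (incl hε).toIntLinearMap) (g := (proj hε).toIntLinearMap)
    (fun x => ker_proj x) (fun a => ⟨mk hε 0 a, rfl⟩)

theorem exists_hom_ne_zero [AddGroup.FG A] {x : CarryExtension hε} (hx : x ≠ 0) :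
    ∃ f : CarryExtension hε →+ ℤ, f x ≠ 0 := by
  by_contra! h
  exact hx ((Module.forall_dual_apply_eq_zero_iff ℤ x).1 fun f => h f.toAddMonoidHom)

end CarryExtension

/-! ### Gordan's theorem and integral approximations of a carry. -/

theorem List.exists_forall_lt {B : Type*} (l : List B) (h : B → ℤ) : ∃ N, ∀ b ∈ l, h b < N := by
  induction l with
  | nil => simp
  | cons a l ih =>
    obtain ⟨N, hN⟩ := ih
    refine ⟨max N (h a + 1), ?_⟩
    simp only [List.mem_cons, forall_eq_or_imp]
    exact ⟨by omega, fun b hb => (hN b hb).trans_le (le_max_left _ _)⟩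

/-- A form of **Gordan's theorem**: finitely many elements of a semigroup which avoids `0` are all
positive under some integral functional, provided the functionals separate points. -/
theorem exists_hom_pos_of_semigroup {B : Type*} [AddCommGroup B]
    (hB : ∀ b : B, b ≠ 0 → ∃ f : B →+ ℤ, f b ≠ 0) (P : B → Prop)
    (hadd : ∀ a b, P a → P b → P (a + b)) (hzero : ¬ P 0) (l : List B) (hl : ∀ b ∈ l, P b) :
    ∃ f : B →+ ℤ, ∀ b ∈ l, 0 < f b := by
  have hsmul : ∀ n : ℤ, 0 < n → ∀ b, P b → P (n • b) := by
    intro n hn b hb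
    induction n, hn using Int.leInduction with
    | base => simpa using hb
    | succ n _ ih =>
      rw [add_smul, one_smul]
      exact hadd _ _ ih hb
  induction h : l.length generalizing l with
  | zero => exact ⟨0, by simp [List.length_eq_zero_iff.1 h]⟩
  | succ n ih =>
    obtain _ | ⟨g, t⟩ := l
    · simp at h
    simp only [List.mem_cons, forall_eq_or_imp] at hl ⊢
    obtain ⟨hg, ht⟩ := hl
    simp only [List.length_cons, Nat.add_right_cancel_iff] at h
    obtain ⟨f, hf⟩ := ih t ht h
    obtain ⟨N, hN⟩ := t.exists_forall_lt f
    rcases lt_trichotomy (f g) 0 with hneg | hfg | hpos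
    -- These combinations are the projections of the `b` along `g` into the kernel of `f`. The
    -- functional chosen below takes the value `-f g` at `g`, and at `b` at least `max N 1 - f b`.
    · obtain ⟨f', hf'⟩ := ih (t.map fun b => f b • g + (-f g) • b) (by
        simp only [List.mem_map, forall_exists_index, and_imp, forall_apply_eq_imp_iff₂]
        exact fun b hb => hadd _ _ (hsmul _ (hf b hb) _ hg)
          (hsmul _ (neg_pos.2 hneg) _ (ht b hb))) (by simpa using h)
      simp only [List.mem_map, forall_exists_index, and_imp, forall_apply_eq_imp_iff₂, map_add,
        map_zsmul, smul_eq_mul] at hf'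
      refine ⟨(max N 1 * -f g) • f' + (max N 1 * f' g - 1) • f, ?_, fun b hb => ?_⟩
      · simp only [AddMonoidHom.add_apply, AddMonoidHom.smul_apply, smul_eq_mul]
        linarith
      · simp only [AddMonoidHom.add_apply, AddMonoidHom.smul_apply, smul_eq_mul]
        have h1 := hf' b hb
        have h2 := hN b hb
        have h3 : max N 1 * 1 ≤ max N 1 * (f b * f' g + -f g * f' b) :=
          mul_le_mul_of_nonneg_left (by omega) (by omega)
        have h4 : f b < max N 1 := lt_max_of_lt_left h2
        linarith
    · obtain ⟨f', hf'⟩ : ∃ f' : B →+ ℤ, 0 < f' g := by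
        obtain ⟨f', hf'⟩ := hB g (by rintro rfl; exact hzero hg)
        rcases lt_or_gt_of_ne hf' with h' | h'
        · exact ⟨-f', by simpa using h'⟩
        · exact ⟨f', h'⟩
      obtain ⟨M, hM⟩ := t.exists_forall_lt fun b => -f' b
      refine ⟨f' + max M 0 • f, ?_, fun b hb => ?_⟩
      · simpa [hfg] using hf'
      · simp only [AddMonoidHom.add_apply, AddMonoidHom.smul_apply, smul_eq_mul]
        have h1 := hM b hb
        have h2 := hf b hb
        have h3 : max M 0 * 1 ≤ max M 0 * f b :=
          mul_le_mul_of_nonneg_left (by omega) (by omega)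
        have h4 : M ≤ max M 0 := le_max_left _ _
        linarith
    · exact ⟨f, hpos, hf⟩

/-- An integer valued function whose failure of additivity is a positive multiple of a given
carry, and which is positive on a given finite set of nonzero elements. -/
theorem IsCarry.exists_quasiHom {A : Type*} [AddCommGroup A] [AddGroup.FG A] {ε : A → A → ℤ}
    (hε : IsCarry ε) (T : Finset A) :
    ∃ (m : ℤ) (f : A → ℤ), 0 < m ∧ (∀ a b, f a + f b = f (a + b) + m * ε a b) ∧
      ∀ w ∈ T, w ≠ 0 → 0 < f w := by
  classical
  obtain ⟨F, hF⟩ := exists_hom_pos_of_semigroup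
    (fun _ h => CarryExtension.exists_hom_ne_zero (hε := hε) h) CarryExtension.Pos
    (fun _ _ h h' => h.add h') CarryExtension.not_pos_zero
    (CarryExtension.mk hε 1 0 :: (T.erase 0).toList.map (CarryExtension.mk hε 0)) (by
      intro b hb
      rcases List.mem_cons.1 hb with rfl | hb
      · simp [CarryExtension.pos_mk]
      · obtain ⟨a, ha, rfl⟩ := List.mem_map.1 hb
        have := (Finset.mem_erase.1 (Finset.mem_toList.1 ha)).1
        simp [CarryExtension.pos_mk, this])
  refine ⟨F (CarryExtension.mk hε 1 0), fun a => F (CarryExtension.mk hε 0 a),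
    hF _ List.mem_cons_self, ?_, fun w hw h0 => hF _ (List.mem_cons_of_mem _
      (List.mem_map_of_mem (Finset.mem_toList.2 (Finset.mem_erase.2 ⟨h0, hw⟩))))⟩
  intro a b
  have h : CarryExtension.mk hε 0 a + CarryExtension.mk hε 0 b =
      CarryExtension.mk hε 0 (a + b) + ε a b • CarryExtension.mk hε 1 0 := by
    have : ε a b • CarryExtension.mk hε 1 0 = CarryExtension.incl hε (ε a b) := by
      change ε a b • CarryExtension.incl hε 1 = _
      rw [← map_zsmul, smul_eq_mul, mul_one]
    rw [this]
    change _ = CarryExtension.mk hε 0 (a + b) + CarryExtension.mk hε (ε a b) 0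
    rw [CarryExtension.mk_add, CarryExtension.mk_add, hε.zero_right]
    simp
  rw [← map_add, h, map_add, map_zsmul, smul_eq_mul, mul_comm]

/-! ### Circular orders from a cyclic quotient and an ordered kernel. -/

/-- The relation on `A` that first compares the representatives of `ψ x` and `ψ y` in
`{0, …, m - 1}`, and then compares elements with the same image by a positivity predicate `Q` on
the kernel of `ψ`. -/
def kernelLex {A : Type*} [AddCommGroup A] {m : ℕ} (ψ : A →+ ZMod m) (Q : A → Prop)
    (x y : A) : Prop :=
  (ψ x).val < (ψ y).val ∨ ψ x = ψ y ∧ Q (y - x)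

/-- `Q` is the positivity predicate of a linear group order on the kernel of `ψ`. -/
structure IsKernelCone {A : Type*} [AddCommGroup A] {m : ℕ} (ψ : A →+ ZMod m)
    (Q : A → Prop) : Prop where
  add : ∀ x y, ψ x = 0 → ψ y = 0 → Q x → Q y → Q (x + y)
  zero : ¬ Q 0
  total : ∀ x, ψ x = 0 → x ≠ 0 → Q x ∨ Q (-x)

section KernelLex

variable {A : Type*} [AddCommGroup A] {m : ℕ} {ψ : A →+ ZMod m} {Q : A → Prop}

theorem IsKernelCone.neg (hQ : IsKernelCone ψ Q) : IsKernelCone ψ fun x => Q (-x) where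
  add x y hx hy h h' := by
    rw [neg_add]
    exact hQ.add _ _ (by simp [hx]) (by simp [hy]) h h'
  zero := by simpa using hQ.zero
  total x hx h0 := hQ.total (-x) (by simp [hx]) (neg_ne_zero.2 h0)

variable [NeZero m]

theorem IsKernelCone.isStrictTotalOrder (hQ : IsKernelCone ψ Q) :
    IsStrictTotalOrder A (kernelLex ψ Q) where
  irrefl x h := by
    rcases h with h | h
    · exact lt_irrefl _ h
    · exact hQ.zero (by simpa using h.2)
  trichotomous x y h1 h2 := by
    by_contra hne
    simp only [kernelLex, not_or, not_and, not_lt] at h1 h2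
    have he : ψ x = ψ y := ZMod.val_injective m (le_antisymm h2.1 h1.1)
    rcases hQ.total (y - x) (by simp [he]) (sub_ne_zero.2 (Ne.symm hne)) with h | h
    · exact h1.2 he h
    · exact h2.2 he.symm (by rwa [neg_sub] at h)
  trans x y z h1 h2 := by
    rcases h1 with h1 | ⟨h1, h1'⟩ <;> rcases h2 with h2 | ⟨h2, h2'⟩
    · exact .inl (h1.trans h2)
    · exact .inl (h2 ▸ h1)
    · exact .inl (h1 ▸ h2)
    · refine .inr ⟨h1.trans h2, ?_⟩
      have := hQ.add (y - x) (z - y) (by simp [h1]) (by simp [h2]) h1' h2'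
      simpa using this

/-- Translation by `g` reverses a comparison exactly when one of the two representatives wraps past
`m` and the other does not. -/
theorem compareSign_kernelLex_add_left (hQ : IsKernelCone ψ Q) (g x y : A) :
    compareSign (kernelLex ψ Q) (g + x) (g + y) = compareSign (kernelLex ψ Q) x y +
      ((if m ≤ (ψ g).val + (ψ x).val then 2 else 0) -
        if m ≤ (ψ g).val + (ψ y).val then 2 else 0) := by
  have := hQ.isStrictTotalOrder
  have aux : ∀ x y, kernelLex ψ Q x y → compareSign (kernelLex ψ Q) (g + x) (g + y) = 1 +
      ((if m ≤ (ψ g).val + (ψ x).val then 2 else 0) -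
        if m ≤ (ψ g).val + (ψ y).val then 2 else 0) := by
    intro x y h
    rcases h with h | ⟨h, h'⟩
    · have hx : (ψ (g + x)).val = ((ψ g).val + (ψ x).val) -
          if m ≤ (ψ g).val + (ψ x).val then m else 0 := by
        rw [map_add]
        split_ifs with hc
        · exact ZMod.val_add_of_le hc
        · exact ZMod.val_add_of_lt (not_le.1 hc)
      have hy : (ψ (g + y)).val = ((ψ g).val + (ψ y).val) -
          if m ≤ (ψ g).val + (ψ y).val then m else 0 := by
        rw [map_add]
        split_ifs with hc
        · exact ZMod.val_add_of_le hc
        · exact ZMod.val_add_of_lt (not_le.1 hc)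
      have hym := ZMod.val_lt (ψ y)
      by_cases hcx : m ≤ (ψ g).val + (ψ x).val <;> by_cases hcy : m ≤ (ψ g).val + (ψ y).val <;>
        simp only [hcx, hcy, if_true, if_false] at hx hy ⊢
      · rw [compareSign_of_lt (.inl (by omega))]
        rfl
      · omega
      · rw [compareSign_of_gt (.inl (by omega))]
        rfl
      · rw [compareSign_of_lt (.inl (by omega))]
        rfl
    · rw [compareSign_of_lt (.inr ⟨by simp [h], by simpa using h'⟩), h]
      ring
  rcases trichotomous_of (kernelLex ψ Q) x y with h | rfl | h
  · rw [aux x y h, compareSign_of_lt h]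
  · simp [compareSign_self]
  · rw [compareSign_swap (g + y), aux y x h, compareSign_of_gt h]
    ring

theorem IsKernelCone.circularClosure_mem_CO (hQ : IsKernelCone ψ Q) :
    circularClosure (kernelLex ψ Q) ∈ CO A :=
  have := hQ.isStrictTotalOrder
  _root_.circularClosure_mem_CO (fun g x => if m ≤ (ψ g).val + (ψ x).val then 2 else 0)
    (compareSign_kernelLex_add_left hQ)

/-- Reversing a nontrivial order of the kernel changes the circular order. -/
theorem IsKernelCone.circularClosure_ne_neg (hQ : IsKernelCone ψ Q) {k : A} (hk : ψ k = 0)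
    (hk0 : k ≠ 0) :
    circularClosure (kernelLex ψ Q) ≠ circularClosure (kernelLex ψ fun x => Q (-x)) := by
  have := hQ.isStrictTotalOrder
  have := hQ.neg.isStrictTotalOrder
  obtain ⟨k, hk, hQk⟩ : ∃ k, ψ k = 0 ∧ Q k := by
    rcases hQ.total k hk hk0 with h | h
    · exact ⟨k, hk, h⟩
    · exact ⟨-k, by simp [hk], h⟩
  intro h
  have h1 := congrArg (fun s : SignType => (s : ℤ)) (congrFun h (0, k, k + k))
  have hQ2 := hQ.add k k hk hk hQk hQk
  simp only [coe_circularClosure] at h1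
  rw [compareSign_of_lt (.inr ⟨by simp [hk], by simpa using hQk⟩),
    compareSign_of_lt (.inr ⟨by simp [hk], by simpa using hQk⟩),
    compareSign_of_gt (.inr ⟨by simp [hk], by simpa using hQ2⟩),
    compareSign_of_gt (.inr ⟨by simp [hk], by simpa using hQk⟩),
    compareSign_of_gt (.inr ⟨by simp [hk], by simpa using hQk⟩),
    compareSign_of_lt (.inr ⟨by simp [hk], by simpa using hQ2⟩)] at h1
  norm_num at h1

end KernelLex

/-! ### Absence of isolated points. -/

theorem circularClosure_congr {A : Type*} {L L' : A → A → Prop} [IsStrictTotalOrder A L]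
    [IsStrictTotalOrder A L'] {S : Set A} (h : ∀ x ∈ S, ∀ y ∈ S, L x y → L' x y)
    {x y z : A} (hx : x ∈ S) (hy : y ∈ S) (hz : z ∈ S) :
    circularClosure L (x, y, z) = circularClosure L' (x, y, z) := by
  have key : ∀ x ∈ S, ∀ y ∈ S, compareSign L x y = compareSign L' x y := by
    intro x hx y hy
    rcases trichotomous_of L x y with hxy | rfl | hxy
    · rw [compareSign_of_lt hxy, compareSign_of_lt (h x hx y hy hxy)]
    · simp [compareSign_self]
    · rw [compareSign_of_gt hxy, compareSign_of_gt (h y hy x hx hxy)]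
  simp only [circularClosure, key x hx y hy, key y hy z hz, key z hz x hx]

/-- On a finitely generated infinite abelian group, no finite set of values determines a
left-invariant circular order. -/
theorem exists_ne_circularOrder_of_finset {A : Type*} [AddCommGroup A] [AddGroup.FG A] [Infinite A]
    {φ : A × A × A → SignType} (hφ : φ ∈ CO A) (S : Finset A) :
    ∃ φ' ∈ CO A, φ' ≠ φ ∧ ∀ x ∈ S, ∀ y ∈ S, ∀ z ∈ S, φ' (x, y, z) = φ (x, y, z) := by
  classical
  have hL := isStrictTotalOrder_cutAtZero hφ.toIsCircularOrder
  have h0 : ∀ x : A, x ≠ 0 → cutAtZero φ 0 x := fun x hx => ⟨hx.symm, .inl rfl⟩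
  have hcl := circularClosure_cutAtZero hφ.toIsCircularOrder
  have hε := isCarry_carry h0 (hcl.symm ▸ hφ)
  -- Including `0` makes both `f x` and `f (-x)` positive for nonzero `x ∈ S`. As they sum to `m`,
  -- `f x` is the representative of `ψ x`.
  set S' := insert 0 S with hS'
  obtain ⟨m, f, hm, hadd, hpos⟩ := hε.exists_quasiHom (Finset.image₂ (fun x y => y - x) S' S')
  lift m to ℕ using hm.le
  have : NeZero m := ⟨by rintro rfl; simp at hm⟩
  have hf0 : f 0 = 0 := by
    have := hadd 0 0
    rw [hε.zero_left, add_zero] at this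
    linarith
  have hfneg : ∀ x, x ≠ 0 → f x + f (-x) = m := by
    intro x hx
    rw [hadd, hε.add_neg x hx, add_neg_cancel, hf0]
    ring
  have hsub : ∀ x ∈ S', ∀ y ∈ S', x ≠ y → 0 < f (y - x) := fun x hx y hy hne =>
    hpos _ (Finset.mem_image₂_of_mem hx hy) (sub_ne_zero.2 hne.symm)
  let ψ : A →+ ZMod m :=
    { toFun := fun x => (f x : ZMod m)
      map_zero' := by simp [hf0]
      map_add' := fun x y => by
        rw [← Int.cast_add, hadd]
        simp }
  have hψ : ∀ x, ψ x = (f x : ZMod m) := fun _ => rfl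
  have hψ0 : ∀ x, ψ x = 0 ↔ (m : ℤ) ∣ f x := fun x => by
    rw [hψ, ZMod.intCast_zmod_eq_zero_iff_dvd]
  have hval : ∀ x ∈ S', ((ψ x).val : ℤ) = f x := by
    intro x hx
    rw [hψ, ZMod.val_intCast]
    by_cases hx0 : x = 0
    · simp [hx0, hf0]
    · have h1 := hsub 0 (by simp [hS']) x hx (Ne.symm hx0)
      have h2 := hsub x hx 0 (by simp [hS']) hx0
      have h3 := hfneg x hx0
      rw [sub_zero] at h1
      rw [zero_sub] at h2
      exact Int.emod_eq_of_lt h1.le (by linarith)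
  -- A kernel element `x` lifts to `(-f x / m, x)` in the kernel of the functional on the extension;
  -- `f x ≤ 0` says that this lift has nonnegative first coordinate.
  have hQ : IsKernelCone ψ fun x => x ≠ 0 ∧ f x ≤ 0 :=
    { add := by
        rintro x y - - ⟨hx, hx'⟩ ⟨hy, hy'⟩
        refine ⟨fun h => ?_, ?_⟩
        · obtain rfl : y = -x := by rw [← add_eq_zero_iff_neg_eq.1 h]
          linarith [hfneg x hx]
        · have := mul_nonneg hm.le (hε.nonneg x y)
          linarith [hadd x y]
      zero := fun h => h.1 rfl
      total := by
        intro x hx hx0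
        obtain ⟨q, hq⟩ := (hψ0 x).1 hx
        have h := hfneg x hx0
        by_contra! hc
        have h1 := hc.1 hx0
        have h2 := hc.2 (neg_ne_zero.2 hx0)
        rw [hq] at h1
        have hq0 : 0 < q := pos_of_mul_pos_right h1 hm.le
        have : (m : ℤ) * 1 ≤ m * q := mul_le_mul_of_nonneg_left hq0 hm.le
        linarith }
  -- If `x` precedes `y`, adding `y - x` to `x` produces no carry, so `f y = f x + f (y - x) > f x`.
  -- The comparison is settled before `Q` matters.
  have hagree : ∀ Q : A → Prop, ∀ x ∈ (S' : Set A), ∀ y ∈ (S' : Set A), cutAtZero φ x y →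
      kernelLex ψ Q x y := by
    intro Q x hx y hy h
    refine .inl ?_
    have h1 := hadd x (y - x)
    have h2 : carry (cutAtZero φ) x (y - x) = 0 := by
      simp [carry, asymm_of (cutAtZero φ) h]
    rw [h2, add_sub_cancel] at h1
    have h3 := hsub x hx y hy h.1
    have h4 := hval x hx
    have h5 := hval y hy
    omega
  have hmem : ∀ x ∈ S, x ∈ (S' : Set A) := fun x hx => by simp [hS', hx]
  have hfinish : ∀ Q : A → Prop, IsKernelCone ψ Q → ∀ x ∈ S, ∀ y ∈ S, ∀ z ∈ S,
      circularClosure (kernelLex ψ Q) (x, y, z) = φ (x, y, z) := by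
    intro Q hQ x hx y hy z hz
    have := hQ.isStrictTotalOrder
    conv_rhs => rw [← hcl]
    exact (circularClosure_congr (hagree Q) (hmem x hx) (hmem y hy) (hmem z hz)).symm
  obtain ⟨a, b, hab, hψab⟩ := Finite.exists_ne_map_eq_of_infinite ψ
  have hne := hQ.circularClosure_ne_neg (k := a - b) (by simp [hψab]) (sub_ne_zero.2 hab)
  by_cases h : circularClosure (kernelLex ψ fun x => x ≠ 0 ∧ f x ≤ 0) = φ
  · exact ⟨_, hQ.neg.circularClosure_mem_CO, fun h' => hne (h.trans h'.symm), hfinish _ hQ.neg⟩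
  · exact ⟨_, hQ.circularClosure_mem_CO, h, hfinish _ hQ⟩

/-! ### Existence, closedness and the conclusion. -/

/-- A finitely generated torsion-free abelian group is orderable. -/
theorem exists_cone_of_isAddTorsionFree (M : Type*) [AddCommGroup M] [Module.Finite ℤ M]
    [Module.IsTorsionFree ℤ M] : ∃ Q : M → Prop, (∀ x y, Q x → Q y → Q (x + y)) ∧ ¬ Q 0 ∧
      ∀ x, x ≠ 0 → Q x ∨ Q (-x) := by
  let b := Module.Free.chooseBasis ℤ M
  let _ : LinearOrder (Module.Free.ChooseBasisIndex ℤ M) := IsWellOrder.linearOrder WellOrderingRel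
  refine ⟨fun x => (0 : Lex (_ →₀ ℤ)) < toLex (b.repr x), fun x y hx hy => ?_, ?_, fun x hx => ?_⟩
  · change 0 < toLex (b.repr (x + y))
    rw [map_add, toLex_add]
    exact add_pos hx hy
  · simp
  · have h : toLex (b.repr x) ≠ 0 := by simpa using hx
    rcases lt_or_gt_of_ne h with h | h
    · refine .inr ?_
      change 0 < toLex (b.repr (-x))
      rw [map_neg, toLex_neg]
      exact neg_pos.2 h
    · exact .inl h

/-- A finitely generated abelian group with cyclic torsion has a left-invariant circular order. -/
theorem nonempty_CO {A : Type*} [AddCommGroup A] [AddGroup.FG A]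
    (htors : IsAddCyclic (AddCommGroup.torsion A)) : (CO A).Nonempty := by
  have : Module.Finite ℤ A := Module.Finite.iff_addGroup_fg.2 inferInstance
  obtain ⟨s, hs⟩ := Module.projective_lifting_property (Submodule.torsion ℤ A).mkQ LinearMap.id
    (Submodule.mkQ_surjective _)
  have hs' : ∀ q, (Submodule.torsion ℤ A).mkQ (s q) = q := fun q => LinearMap.congr_fun hs q
  -- The retraction onto the torsion subgroup given by the splitting `s`; its kernel embeds in the
  -- torsion-free quotient.
  let r : A →+ AddCommGroup.torsion A :=
    { toFun := fun x => ⟨x - s ((Submodule.torsion ℤ A).mkQ x), by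
        rw [← Submodule.torsion_int, Submodule.mem_toAddSubgroup,
          ← Submodule.Quotient.mk_eq_zero, ← Submodule.mkQ_apply, map_sub, hs', sub_self]⟩
      map_zero' := by ext; simp
      map_add' := fun x y => by ext; simp; abel }
  have hr : ∀ x, r x = 0 → (Submodule.torsion ℤ A).mkQ x = 0 → x = 0 := by
    intro x h h'
    have h1 : x - s ((Submodule.torsion ℤ A).mkQ x) = 0 := congrArg Subtype.val h
    rwa [h', map_zero, sub_zero] at h1
  let e := zmodAddCyclicAddEquiv htors
  -- `Nat.card` is `0` for an infinite group, and `ZMod 0` is ℤ; this is excluded because the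
  -- generator `e 1` has finite order.
  have : NeZero (Nat.card (AddCommGroup.torsion A)) := by
    refine ⟨fun h0 => ?_⟩
    obtain ⟨n, hn, h⟩ := isOfFinAddOrder_iff_nsmul_eq_zero.1 (e 1).2
    have h1 : n • e 1 = 0 := Subtype.ext h
    rw [← map_nsmul, EmbeddingLike.map_eq_zero_iff, nsmul_eq_mul, mul_one,
      ZMod.natCast_eq_zero_iff, h0, zero_dvd_iff] at h1
    omega
  obtain ⟨Q, hadd, hzero, htotal⟩ := exists_cone_of_isAddTorsionFree (A ⧸ Submodule.torsion ℤ A)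
  have hQ : IsKernelCone (e.symm.toAddMonoidHom.comp r)
      fun x => Q ((Submodule.torsion ℤ A).mkQ x) :=
    { add := fun x y _ _ hx hy => by
        rw [map_add]
        exact hadd _ _ hx hy
      zero := by
        rwa [map_zero]
      total := fun x hx h0 => by
        rw [map_neg]
        refine htotal _ fun h => h0 (hr x ?_ h)
        simpa using hx }
  exact ⟨_, hQ.circularClosure_mem_CO⟩

theorem isClosed_CO (A : Type*) [AddGroup A] : IsClosed (CO A) := by
  have hev : ∀ t : A × A × A, Continuous fun φ : A × A × A → SignType => (φ t : ℤ) := fun t =>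
    (continuous_of_discreteTopology (f := fun s : SignType => (s : ℤ))).comp (continuous_apply t)
  have h : CO A = (⋂ t : A × A × A, {φ | φ t = 0 ↔ t ∈ degenerateTriples A}) ∩
      (⋂ (a : A) (b : A) (c : A) (d : A), {φ | (φ (b, c, d) : ℤ) - (φ (a, c, d) : ℤ) +
        (φ (a, b, d) : ℤ) - (φ (a, b, c) : ℤ) = 0}) ∩
      ⋂ (g : A) (a : A) (b : A) (c : A), {φ | φ (g + a, g + b, g + c) = φ (a, b, c)} := by
    ext φ
    simp only [Set.mem_inter_iff, Set.mem_iInter, Set.mem_ofPred_eq]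
    constructor
    · exact fun h => ⟨⟨fun t => by rw [← h.preimage_zero]; rfl, h.cocycle⟩, h.homogeneous⟩
    · exact fun h => ⟨⟨Set.ext h.1.1, h.1.2⟩, h.2⟩
  rw [h]
  refine ((isClosed_iInter fun t => ?_).inter (isClosed_iInter fun a => isClosed_iInter fun b =>
    isClosed_iInter fun c => isClosed_iInter fun d => ?_)).inter (isClosed_iInter fun g =>
    isClosed_iInter fun a => isClosed_iInter fun b => isClosed_iInter fun c => ?_)
  · exact (isClosed_discrete {s : SignType | s = 0 ↔ t ∈ degenerateTriples A}).preimage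
      (continuous_apply (A := fun _ : A × A × A => SignType) t)
  · exact isClosed_eq ((((hev _).sub (hev _)).add (hev _)).sub (hev _)) continuous_const
  · exact isClosed_eq (continuous_apply _) (continuous_apply _)

theorem infinite_of_finrank_int_pos {A : Type*} [AddCommGroup A]
    (h : 0 < Module.finrank ℤ A) : Infinite A := by
  by_contra hfin
  rw [not_infinite_iff_finite] at hfin
  have : Module.finrank ℤ A = 0 := by
    rw [← finrank_quotient_torsion_eq]
    have : Subsingleton (A ⧸ (AddCommGroup.torsion A).toIntSubmodule) := by
      rw [Submodule.Quotient.subsingleton_iff, eq_top_iff]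
      exact fun x _ => isOfFinAddOrder_of_finite x
    exact Module.finrank_zero_of_subsingleton
  omega

theorem theorem3p8 {A : Type*} [AddCommGroup A] [AddGroup.FG A]
    (hrank : 0 < Module.finrank ℤ A)
    (htors : IsAddCyclic (AddCommGroup.torsion A)) :
    Nonempty (CO A ≃ₜ cantorSet) := by
  classical
  have := infinite_of_finrank_int_pos hrank
  have : Module.Finite ℤ A := Module.Finite.iff_addGroup_fg.2 inferInstance
  have : Countable A := by
    obtain ⟨n, f, hf⟩ := Module.Finite.exists_fin' ℤ A
    exact hf.countable
  have : CompactSpace (CO A) := isCompact_iff_compactSpace.1 (isClosed_CO A).isCompact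
  have : Nonempty (CO A) := (nonempty_CO htors).to_subtype
  obtain ⟨c, hc⟩ := exists_surjective_nat ((A × A × A) × SignType)
  obtain ⟨e⟩ := nonempty_homeomorph_cantorSpace (X := CO A)
    (C := fun k => {φ | φ.1 (c k).1 = (c k).2}) (fun k =>
      (isClopen_discrete {(c k).2}).preimage ((continuous_apply _).comp continuous_subtype_val))
    (fun φ φ' hne => by
      obtain ⟨t, ht⟩ := Function.ne_iff.1 (Subtype.coe_injective.ne hne)
      obtain ⟨k, hk⟩ := hc (t, φ.1 t)
      refine ⟨k, fun h => ht ?_⟩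
      simp only [Set.mem_ofPred_eq, hk, true_iff] at h
      exact h.symm)
    (by
      intro U hU φ hφ
      obtain ⟨V, hV, rfl⟩ := isOpen_induced_iff.1 hU
      -- A basic neighbourhood constrains finitely many triples; the finite set below collects all
      -- their coordinates.
      obtain ⟨I, u, hu, hIV⟩ := isOpen_pi_iff.1 hV φ.1 hφ
      obtain ⟨φ', hφ', hne, heq⟩ := exists_ne_circularOrder_of_finset φ.2
        (I.image (fun t => t.1) ∪ I.image (fun t => t.2.1) ∪ I.image (fun t => t.2.2))
      refine ⟨⟨φ', hφ'⟩, hIV fun t ht => ?_, fun h => hne (congrArg Subtype.val h)⟩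
      have ht' : φ' t = φ.1 t := by
        refine heq t.1 ?_ t.2.1 ?_ t.2.2 ?_ <;> simp only [Finset.mem_union, Finset.mem_image]
        · exact .inl (.inl ⟨t, ht, rfl⟩)
        · exact .inl (.inr ⟨t, ht, rfl⟩)
        · exact .inr ⟨t, ht, rfl⟩
      change φ' t ∈ u t
      rw [ht']
      exact (hu t ht).2)
  exact ⟨e.trans cantorSetHomeomorphNatToBool.symm⟩
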